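/- Let $d\ge 2$ be an integer. A Coxeter matrix over a finite set $S$ is a matrix $M=(m_{s,t})_{s,t\in S}$ with entries in $\mathbb N\cup\{\infty\}$ such that $m_{s,s}=1$ for all $s \in S$ and $m_{s,t}=m_{t,s}\ge 2$ for all $s\ne t$. Its Artin group is $$A[M]=\langle S \mid \underbrace{sts\cdots}_{m_{s,t}}=\underbrace{tst\cdots}_{m_{s,t}}\ \text{ for all } s,t\in S \text{ with } s\neq t \text{ and } m_{s,t}\ne\infty\rangle .$$ Two Coxeter matrices $M=(m_{s,t})_{s,t\in S}$ and $N=(n_{x,y})_{x,y\in T}$ are isomorphic if there is a bijection $e:S\to T$ with $n_{e(s),e(t)}=m_{s,t}$ for all $s,t\in S$. Let $\mathcal E(1,d)$ be the set of Coxeter matrices (over arbitrary finite sets) all of whose off-diagonal entries lie in $\{2,\infty\}\cup\{2d^r\mid r\ge 1\}$; all such matrices are even, i.e. their off-diagonal entries are even or $\infty$. Then the family of Artin groups $\{A[M] \mid M\in\mathcal E(1,d)\}$ is rigid: for all $M,N\in\mathcal E(1,d)$, the groups $A[M]$ and $A[N]$ are isomorphic if and only if the Coxeter matrices $M$ and $N$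 are isomorphic. -/

import Mathlib

universe u v

/-- The alternating word `s t s ⋯` of length `m`, starting with `s`, evaluated in a monoid. -/
def altWord {G : Type u} [Monoid G] (s t : G) : ℕ → G
  | 0 => 1
  | m + 1 => s * altWord t s m

namespace CoxeterMatrix

/-- The defining relators of the Artin group of `M`, one for each pair `s ≠ t` whose entry is
finite. As everywhere in Mathlib, the entry `∞` of a Coxeter matrix is encoded by `0`. -/
def artinRels {S : Type u} (M : CoxeterMatrix S) : Set (FreeGroup S) :=
  {w | ∃ s t : S, s ≠ t ∧ M s t ≠ 0 ∧
    w = altWord (FreeGroup.of s) (FreeGroup.of t) (M s t) *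
      (altWord (FreeGroup.of t) (FreeGroup.of s) (M s t))⁻¹}

/-- The Artin group `A[M]`: generators `S`, and the relation `s t s ⋯ = t s t ⋯`, with `m_{s,t}`
letters on each side, for all `s ≠ t` with `m_{s,t} ≠ ∞`. -/
abbrev ArtinGroup {S : Type u} (M : CoxeterMatrix S) : Type u :=
  PresentedGroup M.artinRels

/-- Isomorphism of Coxeter matrices: a bijection of the index sets that preserves the entries. -/
def Iso {S : Type u} {T : Type v} (M : CoxeterMatrix S) (N : CoxeterMatrix T) : Prop :=
  ∃ e : S ≃ T, ∀ s t : S, N (e s) (e t) = M s t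

/-- Every off-diagonal entry is even (`∞`, encoded by `0`, counts as even). -/
def IsEven {S : Type u} (M : CoxeterMatrix S) : Prop :=
  ∀ s t : S, s ≠ t → Even (M s t)

/-- The family `𝓔(c,d)`: even Coxeter matrices whose off-diagonal entries lie in
`{2c, ∞} ∪ {2d^r | r ≥ 1}`. -/
def EvenFamily (c d : ℕ) (S : Type u) (M : CoxeterMatrix S) : Prop :=
  M.IsEven ∧ ∀ s t : S, s ≠ t →
    M s t = 2 * c ∨ M s t = 0 ∨ ∃ r : ℕ, 1 ≤ r ∧ M s t = 2 * d ^ r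

/-- The family of Artin groups attached to a family `𝓜` of Coxeter matrices (over finite index
sets) is rigid: the Artin groups of two members are isomorphic if and only if the matrices are. -/
def ArtinRigid (𝓜 : ∀ S : Type u, CoxeterMatrix S → Prop) : Prop :=
  ∀ (S T : Type u) [Finite S] [Finite T] (M : CoxeterMatrix S) (N : CoxeterMatrix T),
    𝓜 S M → 𝓜 T N → (Nonempty (M.ArtinGroup ≃* N.ArtinGroup) ↔ M.Iso N)

end CoxeterMatrix

/-! ### Incidence preorders and label-compatible matrices -/

/-! An isomorphism of the groups induces mutually inverse integer matrices on abelianizations. If `N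
t y = 2n`, killing all generators but `t`, `y` maps the group of `N` to the Heisenberg group over
ℤ/n. The relation of `s`, `x` then forces n to divide `M s x / 2` times the minor in rows `t`, `y`
and columns `s`, `x` (`IsEven.dvd_mul_minor`). The labels form a chain under divisibility with ∞ = 0
on top, so modulo a prime p ∣ d that minor vanishes unless `N t y ∣ M s x`. It remains to do linear
algebra over ℤ/p (`exists_equiv_of_minorCompatible`): Cauchy–Binet identities show that the inverse
matrices respect the domination preorder on vertices. Counting dimensions on its classes gives a
bijection of vertices, and nonzero minors show that it preserves labels. -/

section Incidence

variable {S T : Type*} (a : S → S → ℕ) (b : T → T → ℕ)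

/-- The preorder on the vertices of a labelled graph: every label at `t` divides the corresponding
label at `t'`. -/
def LabelDominates (t t' : T) : Prop :=
  ∀ x, x ≠ t → x ≠ t' → b t x ∣ b t' x

/-- Every `2 × 2` minor of `Φ` in rows `t, y` and columns `s, x` vanishes unless the label of `t, y`
divides the label of `s, x`. -/
def MinorCompatible {K : Type*} [CommRing K] (Φ : Matrix T S K) : Prop :=
  ∀ t y s x, t ≠ y → s ≠ x → ¬ b t y ∣ a s x → Φ t s * Φ y x - Φ y s * Φ t x = 0

variable {a b}

lemma LabelDominates.refl (t : T) : LabelDominates b t t := fun _ _ _ => dvd_rfl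

lemma LabelDominates.trans (hb : ∀ t y, b t y = b y t) {t u v : T}
    (h₁ : LabelDominates b t u) (h₂ : LabelDominates b u v) : LabelDominates b t v := by
  intro x hxt hxv
  -- Domination of `u` says nothing about the label at `u` itself, so this case detours through the
  -- symmetry of `b`.
  by_cases hxu : x = u
  · subst hxu
    by_cases htv : t = v
    · subst htv
      exact dvd_rfl
    · have e₁ := h₁ v (Ne.symm htv) (Ne.symm hxv)
      have e₂ := h₂ t (Ne.symm hxt) htv
      rw [hb t x, hb v x]
      rw [hb v t] at e₂
      exact e₂.trans e₁
  · exact (h₁ x hxt hxu).trans (h₂ x hxu hxv)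

lemma LabelDominates.dvd (hb : ∀ t y, b t y = b y t) {t y u v : T}
    (h₁ : LabelDominates b t u) (h₂ : LabelDominates b y v) (hty : t ≠ y) (huv : u ≠ v) :
    b t y ∣ b u v := by
  by_cases htv : t = v
  · subst htv
    have := (h₂.trans hb h₁) t hty (Ne.symm huv)
    rwa [hb t y]
  · have e₁ := h₁ v (Ne.symm htv) (Ne.symm huv)
    have e₂ := h₂ t hty htv
    rw [hb y t, hb v t] at e₂
    exact e₂.trans e₁

variable {K : Type*} [Field K] {Φ : Matrix T S K} {Ψ : Matrix S T K}

/-- A Cauchy–Binet sum with one index fixed at `s` equals `Φ t s * Ψ s t'`. A nonzero term at `u`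
gives `b t x ∣ a s u ∣ b t' x`. -/
lemma LabelDominates.of_mul_ne_zero [Fintype S] [DecidableEq T] (hΦΨ : Φ * Ψ = 1)
    (hΦ : MinorCompatible a b Φ) (hΨ : MinorCompatible b a Ψ) {t t' : T} {s : S}
    (h : Φ t s ≠ 0) (h' : Ψ s t' ≠ 0) : LabelDominates b t t' := by
  intro x hxt hxt'
  by_contra hdvd
  have htt' : t ≠ t' := by
    rintro rfl
    exact hdvd dvd_rfl
  have entry : ∀ i j, ∑ u, Φ i u * Ψ u j = (1 : Matrix T T K) i j := fun i j => by
    rw [← hΦΨ, Matrix.mul_apply]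
  have key : ∑ u, (Ψ s t' * Ψ u x - Ψ u t' * Ψ s x) * (Φ t s * Φ x u - Φ x s * Φ t u)
      = Φ t s * Ψ s t' := by
    calc
      _ = Φ t s * Ψ s t' * ∑ u, Φ x u * Ψ u x - Ψ s t' * Φ x s * ∑ u, Φ t u * Ψ u x
          - Ψ s x * Φ t s * ∑ u, Φ x u * Ψ u t' + Ψ s x * Φ x s * ∑ u, Φ t u * Ψ u t' := by
        simp only [Finset.mul_sum, ← Finset.sum_sub_distrib, ← Finset.sum_add_distrib]
        exact Finset.sum_congr rfl fun u _ => by ring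
      _ = _ := by
        simp [entry, Matrix.one_apply_ne (Ne.symm hxt), Matrix.one_apply_ne hxt',
          Matrix.one_apply_ne htt']
  refine mul_ne_zero h h' (key.symm.trans (Finset.sum_eq_zero fun u _ => ?_))
  by_cases hsu : s = u
  · subst hsu
    ring
  by_cases hd : a s u ∣ b t' x
  · rw [hΦ t x s u (Ne.symm hxt) hsu fun hd' => hdvd (hd'.trans hd), mul_zero]
  · rw [hΨ s u t' x hsu (Ne.symm hxt') hd, zero_mul]

lemma exists_mul_ne_zero_of_mul_eq_one [Fintype T] [DecidableEq S] (h : Ψ * Φ = 1) (s : S) :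
    ∃ t, Φ t s ≠ 0 ∧ Ψ s t ≠ 0 := by
  have : ∑ t, Ψ s t * Φ t s ≠ 0 := by
    rw [← Matrix.mul_apply, h, Matrix.one_apply_eq]
    exact one_ne_zero
  obtain ⟨t, -, ht⟩ := Finset.exists_ne_zero_of_sum_ne_zero this
  exact ⟨t, right_ne_zero_of_mul ht, left_ne_zero_of_mul ht⟩

/-- Expand the principal minor of the identity at `s`, `x`, keeping products of entries of `Ψ` so
that both entries are nonzero along with the minor of `Φ`. -/
lemma exists_minor_ne_zero_of_mul_eq_one [Fintype T] [DecidableEq S] (h : Ψ * Φ = 1) {s x : S}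
    (hsx : s ≠ x) :
    ∃ t y, Ψ s t ≠ 0 ∧ Ψ x y ≠ 0 ∧ Φ t s * Φ y x - Φ y s * Φ t x ≠ 0 := by
  have entry : ∀ i j, ∑ u, Ψ i u * Φ u j = (1 : Matrix S S K) i j := fun i j => by
    rw [← h, Matrix.mul_apply]
  have key : ∑ t, ∑ y, Ψ s t * Ψ x y * (Φ t s * Φ y x - Φ y s * Φ t x) = 1 := by
    calc
      _ = (∑ t, Ψ s t * Φ t s) * (∑ y, Ψ x y * Φ y x)
          - (∑ t, Ψ s t * Φ t x) * (∑ y, Ψ x y * Φ y s) := by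
        simp only [Finset.sum_mul_sum, ← Finset.sum_sub_distrib]
        exact Finset.sum_congr rfl fun t _ => Finset.sum_congr rfl fun y _ => by ring
      _ = 1 := by simp [entry, Matrix.one_apply_ne hsx]
  obtain ⟨t, -, ht⟩ := Finset.exists_ne_zero_of_sum_ne_zero (key.trans_ne one_ne_zero)
  obtain ⟨y, -, hy⟩ := Finset.exists_ne_zero_of_sum_ne_zero ht
  have h₁ := left_ne_zero_of_mul hy
  exact ⟨t, y, left_ne_zero_of_mul h₁, right_ne_zero_of_mul h₁, right_ne_zero_of_mul hy⟩

/-- Mutually inverse matrices restrict to mutually inverse blocks, if no index outside the block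
contributes to the products; in particular the block is square. -/
lemma card_eq_of_mul_eq_one [Fintype S] [Fintype T] [DecidableEq S] [DecidableEq T]
    (hΦΨ : Φ * Ψ = 1) (hΨΦ : Ψ * Φ = 1) (p : S → Prop) (q : T → Prop)
    [DecidablePred p] [DecidablePred q]
    (hp : ∀ t s t', q t → q t' → Φ t s ≠ 0 → Ψ s t' ≠ 0 → p s)
    (hq : ∀ s t s', p s → p s' → Ψ s t ≠ 0 → Φ t s' ≠ 0 → q t) :
    Fintype.card {s // p s} = Fintype.card {t // q t} := by
  let A : Matrix {t // q t} {s // p s} K := Φ.submatrix Subtype.val Subtype.val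
  let B : Matrix {s // p s} {t // q t} K := Ψ.submatrix Subtype.val Subtype.val
  have hAB : A * B = 1 := by
    ext t t'
    have : ∑ s : {s // p s}, Φ t s * Ψ s t' = ∑ s, Φ t s * Ψ s t' := by
      rw [← Finset.sum_subtype (Finset.univ.filter p) (by simp) fun s => Φ t s * Ψ s t']
      exact Finset.sum_filter_of_ne fun s _ h =>
        hp t s t' t.2 t'.2 (left_ne_zero_of_mul h) (right_ne_zero_of_mul h)
    rw [Matrix.mul_apply]
    refine this.trans ?_
    rw [← Matrix.mul_apply, hΦΨ]
    simp [Matrix.one_apply, Subtype.ext_iff]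
  have hBA : B * A = 1 := by
    ext s s'
    have : ∑ t : {t // q t}, Ψ s t * Φ t s' = ∑ t, Ψ s t * Φ t s' := by
      rw [← Finset.sum_subtype (Finset.univ.filter q) (by simp) fun t => Ψ s t * Φ t s']
      exact Finset.sum_filter_of_ne fun t _ h =>
        hq s t s' s.2 s'.2 (left_ne_zero_of_mul h) (right_ne_zero_of_mul h)
    rw [Matrix.mul_apply]
    refine this.trans ?_
    rw [← Matrix.mul_apply, hΨΦ]
    simp [Matrix.one_apply, Subtype.ext_iff]
  exact Matrix.square_of_invertible B A hBA hAB

/-- Mutually inverse label-compatible matrices force the labelled graphs to be isomorphic. -/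
theorem exists_equiv_of_minorCompatible [Fintype S] [Fintype T] [DecidableEq S] [DecidableEq T]
    (hb : ∀ t y, b t y = b y t)
    (hΦΨ : Φ * Ψ = 1) (hΨΦ : Ψ * Φ = 1)
    (hΦ : MinorCompatible a b Φ) (hΨ : MinorCompatible b a Ψ) :
    ∃ e : S ≃ T, ∀ s x, s ≠ x → b (e s) (e x) = a s x := by
  classical
  have dom : ∀ {t s t'}, Φ t s ≠ 0 → Ψ s t' ≠ 0 → LabelDominates b t t' :=
    fun h h' => LabelDominates.of_mul_ne_zero hΦΨ hΦ hΨ h h'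
  choose c hcΦ hcΨ using exists_mul_ne_zero_of_mul_eq_one hΨΦ
  let r : Setoid T :=
    { r := fun t t' => LabelDominates b t t' ∧ LabelDominates b t' t
      iseqv := ⟨fun t => ⟨.refl t, .refl t⟩, fun h => ⟨h.2, h.1⟩,
        fun h h' => ⟨h.1.trans hb h'.1, h'.2.trans hb h.2⟩⟩ }
  -- If `Φ t s` and `Ψ s t'` are nonzero, then `c s` lies between `t` and `t'` in the preorder;
  -- hence the blocks of each class are mutually inverse.
  have hcard : ∀ z : Quotient r,
      Fintype.card {s // (Quotient.mk r (c s)) = z} = Fintype.card {t // Quotient.mk r t = z} := by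
    intro z
    refine card_eq_of_mul_eq_one hΦΨ hΨΦ _ _ ?_ ?_
    · rintro t s t' rfl ht' h h'
      have e : LabelDominates b t' t ∧ LabelDominates b t t' := Quotient.exact ht'
      exact Quotient.sound
        ⟨(dom (hcΦ s) h').trans hb e.1, dom h (hcΨ s)⟩
    · rintro s t s' rfl hs' h h'
      have e : LabelDominates b (c s') (c s) ∧ LabelDominates b (c s) (c s') := Quotient.exact hs'
      exact Quotient.sound
        ⟨(dom h' (hcΨ s')).trans hb e.1, dom (hcΦ s) h⟩
  let e : S ≃ T := Equiv.ofFiberEquiv fun z => Fintype.equivOfCardEq (hcard z)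
  have he : ∀ s, LabelDominates b (e s) (c s) ∧ LabelDominates b (c s) (e s) := fun s =>
    Quotient.exact (Equiv.ofFiberEquiv_map (fun z => Fintype.equivOfCardEq (hcard z)) s)
  refine ⟨e, fun s x hsx => Nat.dvd_antisymm ?_ ?_⟩
  · obtain ⟨t, y, ht, hy, hm⟩ := exists_minor_ne_zero_of_mul_eq_one hΨΦ hsx
    have hty : t ≠ y := by
      rintro rfl
      exact hm (sub_self _)
    refine (LabelDominates.dvd hb ((he s).1.trans hb (dom (hcΦ s) ht))
      ((he x).1.trans hb (dom (hcΦ x) hy)) (e.injective.ne hsx) hty).trans ?_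
    by_contra hd
    exact hm (hΦ t y s x hty hsx hd)
  -- Transposing exchanges the roles: nonzero entries of `Φ`, and a nonzero minor of `Ψ`, reverse
  -- both divisibilities.
  · have h' : Φ.transpose * Ψ.transpose = 1 := by
      rw [← Matrix.transpose_mul, hΨΦ, Matrix.transpose_one]
    obtain ⟨t, y, ht, hy, hm⟩ := exists_minor_ne_zero_of_mul_eq_one h' hsx
    have hty : t ≠ y := by
      rintro rfl
      exact hm (by simp only [Matrix.transpose_apply]; ring)
    refine dvd_trans ?_ (LabelDominates.dvd hb ((dom ht (hcΨ s)).trans hb (he s).2)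
      ((dom hy (hcΨ x)).trans hb (he x).2) hty (e.injective.ne hsx))
    by_contra hd
    refine hm ?_
    have := hΨ s x t y hsx hty hd
    simp only [Matrix.transpose_apply]
    linear_combination this

end Incidence

/-! ### Alternating words and the Heisenberg group -/

lemma altWord_two_mul {G : Type*} [Monoid G] (s t : G) (n : ℕ) :
    altWord s t (2 * n) = (s * t) ^ n := by
  induction n with
  | zero => rw [mul_zero, pow_zero, altWord]
  | succ n ih => rw [Nat.mul_succ, altWord, altWord, ih, pow_succ', mul_assoc]

lemma map_altWord {G H F : Type*} [Monoid G] [Monoid H] [FunLike F G H] [MonoidHomClass F G H]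
    (f : F) (s t : G) (n : ℕ) : f (altWord s t n) = altWord (f s) (f t) n := by
  induction n generalizing s t with
  | zero => exact map_one f
  | succ n ih => rw [altWord, altWord, map_mul, ih]

/-- The Heisenberg group over `R`: upper unitriangular `3 × 3` matrices, with `x` and `y` on the
superdiagonal and `z` in the corner. -/
@[ext]
structure Heisenberg (R : Type*) where
  x : R
  y : R
  z : R

namespace Heisenberg

variable {R : Type*} [CommRing R]

instance : Group (Heisenberg R) where
  mul g h := ⟨g.x + h.x, g.y + h.y, g.z + h.z + g.x * h.y⟩
  one := ⟨0, 0, 0⟩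
  inv g := ⟨-g.x, -g.y, -g.z + g.x * g.y⟩
  mul_assoc g h k := by
    ext
    · exact add_assoc _ _ _
    · exact add_assoc _ _ _
    · change g.z + h.z + g.x * h.y + k.z + (g.x + h.x) * k.y =
        g.z + (h.z + k.z + h.x * k.y) + g.x * (h.y + k.y)
      ring
  one_mul g := by
    ext
    · exact zero_add _
    · exact zero_add _
    · change 0 + g.z + 0 * g.y = g.z
      ring
  mul_one g := by
    ext
    · exact add_zero _
    · exact add_zero _
    · change g.z + 0 + g.x * 0 = g.z
      ring
  inv_mul_cancel g := by
    ext
    · exact neg_add_cancel _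
    · exact neg_add_cancel _
    · change -g.z + g.x * g.y + g.z + -g.x * g.y = 0
      ring

lemma mul_def (g h : Heisenberg R) :
    g * h = ⟨g.x + h.x, g.y + h.y, g.z + h.z + g.x * h.y⟩ := rfl

lemma one_def : (1 : Heisenberg R) = ⟨0, 0, 0⟩ := rfl

/-- The projection of the Heisenberg group to its first superdiagonal coordinate. -/
def xHom : Heisenberg R →* Multiplicative R where
  toFun g := Multiplicative.ofAdd g.x
  map_one' := rfl
  map_mul' _ _ := rfl

/-- The projection of the Heisenberg group to its second superdiagonal coordinate. -/
def yHom : Heisenberg R →* Multiplicative R where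
  toFun g := Multiplicative.ofAdd g.y
  map_one' := rfl
  map_mul' _ _ := rfl

lemma central_pow (c : R) (n : ℕ) :
    (⟨0, 0, c⟩ : Heisenberg R) ^ n = ⟨0, 0, n * c⟩ := by
  induction n with
  | zero => simp [one_def]
  | succ n ih =>
    rw [pow_succ, ih, mul_def]
    ext <;> simp
    ring

/-- The two products differ by a central element whose corner entry is the determinant, and its n-th
power is the whole discrepancy. -/
lemma mul_pow_eq_mul_pow_iff (g h : Heisenberg R) (n : ℕ) :
    (g * h) ^ n = (h * g) ^ n ↔ (n : R) * (g.x * h.y - g.y * h.x) = 0 := by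
  have hc : g * h = h * g * ⟨0, 0, g.x * h.y - g.y * h.x⟩ := by
    simp only [mul_def]
    ext <;> ring
  have hcomm : Commute (h * g) ⟨0, 0, g.x * h.y - g.y * h.x⟩ := by
    simp only [commute_iff_eq, mul_def]
    ext <;> ring
  rw [hc, hcomm.mul_pow, mul_eq_left, central_pow, one_def, Heisenberg.mk.injEq]
  simp

end Heisenberg

/-! ### Even Artin groups -/

namespace CoxeterMatrix

variable {S T : Type*}

lemma altWord_of_eq (M : CoxeterMatrix S) {s t : S} (hst : s ≠ t) (h : M s t ≠ 0) :
    altWord (PresentedGroup.of s : M.ArtinGroup) (PresentedGroup.of t) (M s t) =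
      altWord (PresentedGroup.of t) (PresentedGroup.of s) (M s t) := by
  have := PresentedGroup.one_of_mem (rels := M.artinRels) ⟨s, t, hst, h, rfl⟩
  rw [map_mul, map_inv, mul_inv_eq_one, map_altWord, map_altWord] at this
  exact this

/-- A map to a group that satisfies the braid relations of an even Coxeter matrix extends to its
Artin group. -/
def IsEven.lift {M : CoxeterMatrix S} (hM : M.IsEven) {G : Type*} [Group G] (f : S → G)
    (hf : ∀ s t, s ≠ t → (f s * f t) ^ (M s t / 2) = (f t * f s) ^ (M s t / 2)) :
    M.ArtinGroup →* G :=
  PresentedGroup.toGroup (f := f) (by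
    rintro _ ⟨s, t, hst, -, rfl⟩
    rw [map_mul, map_inv, mul_inv_eq_one, map_altWord, map_altWord, FreeGroup.lift_apply_of,
      FreeGroup.lift_apply_of, ← Nat.two_mul_div_two_of_even (hM s t hst), altWord_two_mul,
      altWord_two_mul]
    exact hf s t hst)

@[simp]
lemma IsEven.lift_of {M : CoxeterMatrix S} (hM : M.IsEven) {G : Type*} [Group G] (f : S → G)
    (hf : ∀ s t, s ≠ t → (f s * f t) ^ (M s t / 2) = (f t * f s) ^ (M s t / 2)) (s : S) :
    hM.lift f hf (PresentedGroup.of s) = f s :=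
  PresentedGroup.toGroup.of _

/-- Since ∞ is encoded by 0, the exponent is 0 for a pair without relation, so no finiteness
assumption is needed. -/
lemma IsEven.mul_pow_of_eq {M : CoxeterMatrix S} (hM : M.IsEven) {s t : S} (hst : s ≠ t) :
    ((PresentedGroup.of s : M.ArtinGroup) * PresentedGroup.of t) ^ (M s t / 2) =
      (PresentedGroup.of t * PresentedGroup.of s) ^ (M s t / 2) := by
  by_cases h : M s t = 0
  · rw [h, Nat.zero_div, pow_zero, pow_zero]
  · have := M.altWord_of_eq hst h
    rwa [← Nat.two_mul_div_two_of_even (hM s t hst), altWord_two_mul, altWord_two_mul] at this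

lemma EvenFamily.eq_zero_or_eq_two_mul_pow {d : ℕ} {M : CoxeterMatrix S}
    (hM : EvenFamily 1 d S M) {s t : S} (hst : s ≠ t) :
    M s t = 0 ∨ ∃ r : ℕ, M s t = 2 * d ^ r := by
  rcases hM.2 s t hst with h | h | ⟨r, -, h⟩
  · exact .inr ⟨0, by rw [h, pow_zero]⟩
  · exact .inl h
  · exact .inr ⟨r, h⟩

/-! ### Exponent sums, Heisenberg quotients and congruences for minors -/

section Exponents

variable [DecidableEq S] [DecidableEq T]

/-- The exponent sum of the generator `t`, as a homomorphism to the integers. -/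
def IsEven.exponent {M : CoxeterMatrix S} (hM : M.IsEven) (t : S) :
    M.ArtinGroup →* Multiplicative ℤ :=
  hM.lift (fun s => Multiplicative.ofAdd (if s = t then 1 else 0)) fun _ _ _ => by rw [mul_comm]

/-- The homomorphism to the Heisenberg group over `ℤ/n`, with `2n = m_{t,y}`, that is trivial on all
generators but `t` and `y`. -/
def IsEven.toHeisenberg {M : CoxeterMatrix S} (hM : M.IsEven) (t y : S) :
    M.ArtinGroup →* Heisenberg (ZMod (M t y / 2)) :=
  hM.lift (fun s => ⟨if s = t then 1 else 0, if s = y then 1 else 0, 0⟩) fun u v huv => by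
    rw [Heisenberg.mul_pow_eq_mul_pow_iff]
    -- The exponent is zero in ℤ/n for the pair `t`, `y` in either order; for any other pair the
    -- determinant vanishes.
    by_cases h₁ : u = t ∧ v = y
    · rw [h₁.1, h₁.2, ZMod.natCast_self, zero_mul]
    by_cases h₂ : v = t ∧ u = y
    · rw [h₂.1, h₂.2, M.symmetric y t, ZMod.natCast_self, zero_mul]
    have e₁ : (if u = t then (1 : ZMod (M t y / 2)) else 0) * (if v = y then 1 else 0) = 0 := by
      rw [ite_zero_mul_ite_zero, if_neg h₁]
    have e₂ : (if u = y then (1 : ZMod (M t y / 2)) else 0) * (if v = t then 1 else 0) = 0 := by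
      rw [ite_zero_mul_ite_zero, if_neg fun h => h₂ ⟨h.2, h.1⟩]
    rw [e₁, e₂, sub_zero, mul_zero]

lemma IsEven.toHeisenberg_x {M : CoxeterMatrix S} (hM : M.IsEven) (t y : S) (g : M.ArtinGroup) :
    (hM.toHeisenberg t y g).x = ((hM.exponent t g).toAdd : ZMod (M t y / 2)) := by
  have : Heisenberg.xHom.comp (hM.toHeisenberg t y) =
      (AddMonoidHom.toMultiplicative (Int.castAddHom (ZMod (M t y / 2)))).comp
        (hM.exponent t) := by
    ext s
    simp [Heisenberg.xHom, toHeisenberg, exponent]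
  exact congrArg Multiplicative.toAdd (DFunLike.congr_fun this g)

lemma IsEven.toHeisenberg_y {M : CoxeterMatrix S} (hM : M.IsEven) (t y : S) (g : M.ArtinGroup) :
    (hM.toHeisenberg t y g).y = ((hM.exponent y g).toAdd : ZMod (M t y / 2)) := by
  have : Heisenberg.yHom.comp (hM.toHeisenberg t y) =
      (AddMonoidHom.toMultiplicative (Int.castAddHom (ZMod (M t y / 2)))).comp
        (hM.exponent y) := by
    ext s
    simp [Heisenberg.yHom, toHeisenberg, exponent]
  exact congrArg Multiplicative.toAdd (DFunLike.congr_fun this g)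

variable {M : CoxeterMatrix S} {N : CoxeterMatrix T}

/-- The matrix that a homomorphism of even Artin groups induces on the abelianizations. -/
def IsEven.exponentMatrix (hN : N.IsEven) (f : M.ArtinGroup →* N.ArtinGroup) : Matrix T S ℤ :=
  fun t s => (hN.exponent t (f (PresentedGroup.of s))).toAdd

lemma IsEven.exponent_map [Fintype S] (hM : M.IsEven) (hN : N.IsEven)
    (f : M.ArtinGroup →* N.ArtinGroup) (t : T) (g : M.ArtinGroup) :
    (hN.exponent t (f g)).toAdd =
      ∑ s, hN.exponentMatrix f t s * (hM.exponent s g).toAdd := by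
  let F : M.ArtinGroup →* Multiplicative ℤ :=
    { toFun := fun g =>
        Multiplicative.ofAdd (∑ s, hN.exponentMatrix f t s * (hM.exponent s g).toAdd)
      map_one' := by simp
      map_mul' := fun g h => by simp [mul_add, Finset.sum_add_distrib] }
  have : (hN.exponent t).comp f = F := by
    ext s
    simp [F, exponentMatrix, exponent]
  exact congrArg Multiplicative.toAdd (DFunLike.congr_fun this g)

lemma IsEven.exponentMatrix_mul [Fintype S] (hM : M.IsEven) (hN : N.IsEven)
    (f : M.ArtinGroup →* N.ArtinGroup) (g : N.ArtinGroup →* M.ArtinGroup)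
    (hfg : ∀ x, f (g x) = x) :
    hN.exponentMatrix f * hM.exponentMatrix g = 1 := by
  ext t t'
  rw [Matrix.mul_apply]
  refine (hM.exponent_map hN f t (g (PresentedGroup.of t'))).symm.trans ?_
  rw [hfg]
  simp [exponent, Matrix.one_apply, eq_comm]

/-- The relation between `s` and `x` constrains the minors of the exponent matrix. -/
lemma IsEven.dvd_mul_minor (hM : M.IsEven) (hN : N.IsEven) (f : M.ArtinGroup →* N.ArtinGroup)
    (t y : T) {s x : S} (hsx : s ≠ x) :
    ((N t y / 2 : ℕ) : ℤ) ∣ ((M s x / 2 : ℕ) : ℤ) *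
      (hN.exponentMatrix f t s * hN.exponentMatrix f y x -
        hN.exponentMatrix f y s * hN.exponentMatrix f t x) := by
  have h := congrArg (fun g => hN.toHeisenberg t y (f g)) (hM.mul_pow_of_eq hsx)
  simp only [map_pow, map_mul] at h
  rw [Heisenberg.mul_pow_eq_mul_pow_iff, toHeisenberg_x, toHeisenberg_y, toHeisenberg_x,
    toHeisenberg_y] at h
  rw [← CharP.intCast_eq_zero_iff (ZMod (N t y / 2))]
  simp only [Int.cast_mul, Int.cast_sub, Int.cast_natCast]
  exact h

/-- Within `𝓔(1, d)`, the exponent matrix modulo a divisor of `d` is label-compatible. -/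
lemma EvenFamily.minorCompatible_exponentMatrix {d p : ℕ} (hpd : p ∣ d)
    (hM : EvenFamily 1 d S M) (hN : EvenFamily 1 d T N) (f : M.ArtinGroup →* N.ArtinGroup) :
    MinorCompatible (M · ·) (N · ·) ((hN.1.exponentMatrix f).map (Int.castRingHom (ZMod p))) := by
  intro t y s x hty hsx hdvd
  change ¬ N t y ∣ M s x at hdvd
  have h := hM.1.dvd_mul_minor hN.1 f t y hsx
  simp only [Matrix.map_apply, ← map_mul, ← map_sub]
  generalize hN.1.exponentMatrix f t s * hN.1.exponentMatrix f y x -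
    hN.1.exponentMatrix f y s * hN.1.exponentMatrix f t x = D at h ⊢
  refine (CharP.intCast_eq_zero_iff (ZMod p) p D).2 ?_
  obtain hs | ⟨r, hs⟩ := hM.eq_zero_or_eq_two_mul_pow hsx
  · exact absurd (by rw [hs]; exact dvd_zero _) hdvd
  obtain ht | ⟨k, ht⟩ := hN.eq_zero_or_eq_two_mul_pow hty
  -- For the label ∞ the modulus is 0, so the minor vanishes already over ℤ.
  · rw [hs, ht, Nat.mul_div_cancel_left _ two_pos, Nat.zero_div, Nat.cast_zero, zero_dvd_iff,
      mul_eq_zero] at h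
    rcases h with h | h
    · have : d ^ r = 0 := by exact_mod_cast h
      exact absurd (by rw [hs, this, mul_zero]; exact dvd_zero _) hdvd
    · rw [h]
      exact dvd_zero _
  · have hrk : r < k := by
      by_contra! hkr
      exact hdvd (by rw [hs, ht]; exact mul_dvd_mul_left 2 (pow_dvd_pow d hkr))
    have hd : (d : ℤ) ^ r ≠ 0 := by
      intro h0
      have : d ^ r = 0 := by exact_mod_cast h0
      exact hdvd (by rw [hs, this, mul_zero]; exact dvd_zero _)
    rw [hs, ht, Nat.mul_div_cancel_left _ two_pos, Nat.mul_div_cancel_left _ two_pos] at h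
    push_cast at h
    -- As r < k, cancelling `d ^ r` leaves at least one factor `d` dividing the minor.
    have h₁ : (d : ℤ) ^ r * d ∣ d ^ r * D := (pow_succ (d : ℤ) r ▸ pow_dvd_pow _ hrk).trans h
    exact (Int.natCast_dvd_natCast.2 hpd).trans ((mul_dvd_mul_iff_left hd).1 h₁)

end Exponents

section Iso

lemma IsEven.map_of_labels {M : CoxeterMatrix S} {N : CoxeterMatrix T} (hN : N.IsEven)
    {e : S → T} (he : e.Injective) (h : ∀ s x, N (e s) (e x) = M s x) (s x : S) (hsx : s ≠ x) :
    ((PresentedGroup.of (e s) : N.ArtinGroup) * PresentedGroup.of (e x)) ^ (M s x / 2) =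
      (PresentedGroup.of (e x) * PresentedGroup.of (e s)) ^ (M s x / 2) := by
  rw [← h]
  exact hN.mul_pow_of_eq (he.ne hsx)

/-- Isomorphic even Coxeter matrices have isomorphic Artin groups. -/
lemma IsEven.nonempty_mulEquiv_of_iso {M : CoxeterMatrix S} {N : CoxeterMatrix T} (hM : M.IsEven)
    (hN : N.IsEven) (h : M.Iso N) : Nonempty (M.ArtinGroup ≃* N.ArtinGroup) := by
  obtain ⟨e, he⟩ := h
  have he' : ∀ t y, M (e.symm t) (e.symm y) = N t y := fun t y => by
    rw [← he, e.apply_symm_apply, e.apply_symm_apply]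
  refine ⟨MonoidHom.toMulEquiv (hM.lift _ (hN.map_of_labels e.injective he))
    (hN.lift _ (hM.map_of_labels e.symm.injective he')) ?_ ?_⟩
  · ext s
    simp
  · ext t
    simp

end Iso

end CoxeterMatrix

theorem corollary5p2 (d : ℕ) (hd : 2 ≤ d) :
    CoxeterMatrix.ArtinRigid.{u} (CoxeterMatrix.EvenFamily.{u} 1 d) := by
  intro S T _ _ M N hM hN
  refine ⟨?_, hM.1.nonempty_mulEquiv_of_iso hN.1⟩
  rintro ⟨φ⟩
  classical
  have := Fintype.ofFinite S
  have := Fintype.ofFinite T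
  -- Any prime factor of `d` would do; it is only needed to reduce to a field.
  have : Fact d.minFac.Prime := ⟨Nat.minFac_prime (by omega)⟩
  have hpd := Nat.minFac_dvd d
  have mul_eq_one : ∀ {U V : Type u} [Fintype V] [DecidableEq U] {A : Matrix U V ℤ}
      {B : Matrix V U ℤ}, A * B = 1 → A.map (Int.castRingHom (ZMod d.minFac)) *
        B.map (Int.castRingHom (ZMod d.minFac)) = 1 := fun h => by
    rw [← Matrix.map_mul, h, Matrix.map_one _ (map_zero _) (map_one _)]
  obtain ⟨e, he⟩ := exists_equiv_of_minorCompatible N.symmetric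
    (mul_eq_one <| hM.1.exponentMatrix_mul hN.1 φ.toMonoidHom φ.symm.toMonoidHom
      φ.apply_symm_apply)
    (mul_eq_one <| hN.1.exponentMatrix_mul hM.1 φ.symm.toMonoidHom φ.toMonoidHom
      φ.symm_apply_apply)
    (hM.minorCompatible_exponentMatrix hpd hN φ.toMonoidHom)
    (hN.minorCompatible_exponentMatrix hpd hM φ.symm.toMonoidHom)
  refine ⟨e, fun s x => ?_⟩
  by_cases hsx : s = x
  · rw [hsx, N.diagonal, M.diagonal]
  · exact he s x hsx
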